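/- Let $d\ge 2$ be an integer and let $\log$ be the natural logarithm. A state of dimension $d$ is a positive semidefinite complex $d\times d$ matrix of trace $1$; classical states, i.e. probability distributions on $d$ points, are identified with the diagonal ones. For states $\sigma,\rho$ let $S(\rho)=-\operatorname{tr}(\rho\log\rho)$ (with $0\log 0=0$), and let $D(\sigma\|\rho)=\operatorname{tr}(\sigma\log\sigma)-\operatorname{tr}(\sigma\log\rho)$ if the support (range) of $\sigma$ is contained in that of $\rho$, and $D(\sigma\|\rho)=+\infty$ otherwise. For $x,y\in[0,1]$ let $H_2(x)=-x\log x-(1-x)\log(1-x)$ and $D_2(x\|y)=x\log\frac{x}{y}+(1-x)\log\frac{1-x}{1-y}\in[0,+\infty]$ (a term $a\log\frac{a}{b}$ is $0$ if $a=0$ and $+\infty$ if $a>0=b$). For $\Delta\in[-\log d,\log d]$ let $$M(\Delta,d)=\min\Big\{D_2(s\|r)\ \Big|\ 0\le s,r\le \tfrac{d-1}{d},\ H_2(s)-H_2(r)+(s-r)\log(d-1)=\Delta\Big\}\in[0,+\infty].$$ (i) For all states $\sigma,\rho$ of dimension $d$, the number $\Delta:=S(\sigma)-S(\rho)$ lies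 in $[-\log d,\log d]$ and $D(\sigma\|\rho)\ge M(\Delta,d)$. (ii) Conversely, for every $\Delta\in[-\log d,\log d]$ the minimum defining $M(\Delta,d)$ is attained by some pair $(s,r)$, and there are states $\sigma,\rho$ of dimension $d$, which can be chosen diagonal, with $S(\sigma)-S(\rho)=\Delta$ and $D(\sigma\|\rho)=M(\Delta,d)$. More precisely, for every pair $(s,r)$ attaining the minimum, the commuting matrices $$\sigma=\operatorname{diag}\Big(1-s,\tfrac{s}{d-1},\ldots,\tfrac{s}{d-1}\Big),\qquad \rho=\operatorname{diag}\Big(1-r,\tfrac{r}{d-1},\ldots,\tfrac{r}{d-1}\Big)$$ are states of dimension $d$ with $S(\sigma)-S(\rho)=\Delta$ and $D(\sigma\|\rho)=M(\Delta,d)$. -/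

import Mathlib

open scoped ComplexOrder

noncomputable section

/-- A state of dimension `d`: a positive semidefinite complex `d × d` matrix of trace one.
Classical states (probability distributions) are the diagonal ones. -/
structure IsState {d : ℕ} (ρ : Matrix (Fin d) (Fin d) ℂ) : Prop where
  posSemidef : ρ.PosSemidef
  trace_eq_one : ρ.trace = 1

/-- The matrix logarithm, by the functional calculus of Hermitian matrices. Since `Real.log 0 = 0`,
it is the logarithm on the support of `ρ`, extended by zero to the kernel. -/
def matLog {d : ℕ} (ρ : Matrix (Fin d) (Fin d) ℂ) : Matrix (Fin d) (Fin d) ℂ :=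
  cfc Real.log ρ

/-- The entropy `S(ρ) = -tr(ρ log ρ)`, with `0 log 0 = 0`. -/
def entropy {d : ℕ} (ρ : Matrix (Fin d) (Fin d) ℂ) : ℝ :=
  -(ρ * matLog ρ).trace.re

/-- The support of a Hermitian matrix: its range, the orthogonal complement of its kernel. -/
def matSupport {d : ℕ} (ρ : Matrix (Fin d) (Fin d) ℂ) : Submodule ℂ (Fin d → ℂ) :=
  LinearMap.range ρ.mulVecLin

open Classical in
/-- The relative entropy `D(σ‖ρ) = tr(σ log σ) - tr(σ log ρ)`, which is `+∞` if the support of `σ`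
is not contained in the support of `ρ`. -/
def relEntropy {d : ℕ} (σ ρ : Matrix (Fin d) (Fin d) ℂ) : EReal :=
  if matSupport σ ≤ matSupport ρ then
    (((σ * matLog σ).trace.re - (σ * matLog ρ).trace.re : ℝ) : EReal)
  else ⊤

open Classical in
/-- The binary relative entropy `D₂(x‖y) = x log (x/y) + (1-x) log ((1-x)/(1-y))` of
`x, y ∈ [0, 1]`, which is `+∞` if `y = 0 < x` or `1 - y = 0 < 1 - x`. -/
def binRelEntropy (x y : ℝ) : EReal :=
  if (y = 0 → x = 0) ∧ (1 - y = 0 → 1 - x = 0) then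
    ((x * Real.log (x / y) + (1 - x) * Real.log ((1 - x) / (1 - y)) : ℝ) : EReal)
  else ⊤

/-- The pairs `(s, r)` with `0 ≤ s, r ≤ (d-1)/d` and
`H₂(s) - H₂(r) + (s - r) log (d - 1) = Δ`. -/
def feasiblePairs (Δ : ℝ) (d : ℕ) : Set (ℝ × ℝ) :=
  {p | p.1 ∈ Set.Icc (0 : ℝ) (((d : ℝ) - 1) / d) ∧ p.2 ∈ Set.Icc (0 : ℝ) (((d : ℝ) - 1) / d) ∧
    Real.binEntropy p.1 - Real.binEntropy p.2 + (p.1 - p.2) * Real.log ((d : ℝ) - 1) = Δ}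

/-- `M(Δ, d)`: the infimum of `D₂(s‖r)` over the feasible pairs `(s, r)`. -/
def entropyGapBound (Δ : ℝ) (d : ℕ) : EReal :=
  ⨅ p ∈ feasiblePairs Δ d, binRelEntropy p.1 p.2

/-- `(s, r)` is a feasible pair that attains the minimum of `D₂` over the feasible pairs. -/
def IsMinimizingPair (Δ : ℝ) (d : ℕ) (s r : ℝ) : Prop :=
  (s, r) ∈ feasiblePairs Δ d ∧
    IsMinOn (fun p : ℝ × ℝ => binRelEntropy p.1 p.2) (feasiblePairs Δ d) (s, r)

/-- The diagonal matrix `diag(1 - s, s/(d-1), …, s/(d-1))`. -/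
def spikeState (d : ℕ) (s : ℝ) : Matrix (Fin d) (Fin d) ℂ :=
  Matrix.diagonal fun i =>
    ((if (i : ℕ) = 0 then 1 - s else s / ((d : ℝ) - 1) : ℝ) : ℂ)

end

/-!
Two spikes `(1 - s, s / (d - 1), …, s / (d - 1))` and `(1 - r, r / (d - 1), …, r / (d - 1))` have
the entropies `qaryEntropy d s` and `qaryEntropy d r`, and their relative entropy is `D₂(s‖r)`. As
`qaryEntropy d` increases from `0` to `log d` on `[0, (d - 1) / d]`, states `σ`, `ρ` determine a
feasible pair `(s, r)` with the entropies of `σ` and `ρ`. The inequality follows from the stronger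
fact that `D(σ‖ρ) ≥ D₂(s‖r)` for this pair (`binRelEntropy_le_relEntropy`). With both entropies
fixed, this is a lower bound for the cross entropy `E = -tr (σ log ρ) = -∑ p log q`, where `q` is
the spectrum of `ρ` and `p` the diagonal of `σ` in an eigenbasis of `ρ`; by concavity
`S(σ) ≤ H(p)` (`entropy_le_sum_negMulLog_eigenWeight`).

For every `β > 0` the Gibbs variational principle gives `H(p) ≤ log ∑ q ^ β + β E`
(`sum_negMulLog_le_log_sum_rpow`), with equality if `p` is proportional to `q ^ β`. A power of a
spike is proportional to a spike, so equality occurs for any two spikes with a suitable `β`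
(`exists_log_sum_rpow_spike_eq`). It remains to see that among the distributions `q` with a given
entropy the spike maximises `∑ q ^ β`, for all `β > 0` simultaneously (`sum_rpow_le`). Let `u < v`
be the two entries of the spike. By Fano's inequality no entry of `q` exceeds `v`. On `[0, v]` the
function `x ^ β` lies below the combination of `1`, `x` and `x log x` that is tangent to it at `u`
and meets it at `v` (`taylor_rpow_mul_taylor_mul_log_le`), and the sum over the entries of such a
combination depends only on the entropy.

The minimum is attained because the feasible set is compact and the binary relative entropy is lower
semicontinuous on it.
-/

/-! ### Gibbs' inequality and the Gibbs variational principle -/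

theorem cast_sub_one_pos {d : ℕ} (hd : 2 ≤ d) : (0 : ℝ) < (d : ℝ) - 1 := by
  have : (2 : ℝ) ≤ d := by exact_mod_cast hd
  linarith

theorem cast_sub_one_div_lt_one {d : ℕ} (hd : 2 ≤ d) : ((d : ℝ) - 1) / d < 1 := by
  rw [div_lt_one (by positivity)]
  linarith

open Real Finset in
theorem sum_rpow_pos {ι : Type*} [Fintype ι] {q : ι → ℝ} (hq : ∀ i, 0 ≤ q i)
    (hq1 : ∑ i, q i = 1) (β : ℝ) : 0 < ∑ i, q i ^ β := by
  obtain ⟨i, -, hi⟩ : ∃ i ∈ univ, q i ≠ 0 := by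
    by_contra! h
    simp [sum_eq_zero h] at hq1
  exact sum_pos' (fun j _ => rpow_nonneg (hq j) _)
    ⟨i, mem_univ i, rpow_pos_of_pos (lt_of_le_of_ne (hq i) hi.symm) _⟩

open Real Finset in
/-- **Gibbs' inequality**. -/
theorem sum_negMulLog_le_neg_sum_mul_log {ι : Type*} [Fintype ι] {p w : ι → ℝ}
    (hp : ∀ i, 0 ≤ p i) (hw : ∀ i, 0 ≤ w i) (hsum : ∑ i, w i ≤ ∑ i, p i)
    (hpw : ∀ i, w i = 0 → p i = 0) :
    ∑ i, negMulLog (p i) ≤ -∑ i, p i * log (w i) := by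
  have key : ∀ i, negMulLog (p i) + p i * log (w i) ≤ w i - p i := by
    intro i
    rcases (hp i).eq_or_lt with h | h
    · simp [← h, hw i]
    · have hwi : 0 < w i := lt_of_le_of_ne (hw i) fun h0 => h.ne' (hpw i h0.symm)
      have := mul_le_mul_of_nonneg_left (log_le_sub_one_of_pos (div_pos hwi h)) h.le
      rw [log_div hwi.ne' h.ne', mul_sub, mul_sub, mul_div_cancel₀ _ h.ne'] at this
      rw [negMulLog]
      linarith
  have := sum_le_sum fun i (_ : i ∈ univ) => key i
  rw [sum_add_distrib, sum_sub_distrib] at this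
  linarith

open Real Finset in
/-- The Gibbs variational principle: the entropy of `p` is at most `log ∑ q ^ β` plus `β` times the
cross entropy of `p` and `q`. -/
theorem sum_negMulLog_le_log_sum_rpow {ι : Type*} [Fintype ι] {p q : ι → ℝ}
    (hp : ∀ i, 0 ≤ p i) (hp1 : ∑ i, p i = 1) (hq : ∀ i, 0 ≤ q i) (hq1 : ∑ i, q i = 1)
    (hpq : ∀ i, q i = 0 → p i = 0) {β : ℝ} (hβ : 0 < β) :
    ∑ i, negMulLog (p i) ≤ log (∑ i, q i ^ β) + β * -∑ i, p i * log (q i) := by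
  set Z := ∑ i, q i ^ β with hZ
  have hZpos : 0 < Z := sum_rpow_pos hq hq1 β
  have h := sum_negMulLog_le_neg_sum_mul_log (p := p) (w := fun i => q i ^ β / Z) hp
    (fun i => div_nonneg (rpow_nonneg (hq i) _) hZpos.le)
    (by rw [← sum_div, ← hZ, div_self hZpos.ne', hp1])
    (fun i hi => hpq i <| by
      rw [div_eq_zero_iff, or_iff_left hZpos.ne', rpow_eq_zero (hq i) hβ.ne'] at hi
      exact hi)
  refine h.trans_eq ?_
  have : ∀ i, p i * log (q i ^ β / Z) = β * (p i * log (q i)) - p i * log Z := by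
    intro i
    rcases (hq i).eq_or_lt with h0 | h0
    · simp [hpq i h0.symm]
    · rw [log_div (rpow_pos_of_pos h0 _).ne' hZpos.ne', log_rpow h0]
      ring
  simp only [this, sum_sub_distrib, ← mul_sum, ← sum_mul, hp1]
  ring

open Real Finset in
theorem sum_negMulLog_le_log_card {d : ℕ} (hd : 2 ≤ d) {p : Fin d → ℝ} (hp : ∀ i, 0 ≤ p i)
    (hp1 : ∑ i, p i = 1) : ∑ i, negMulLog (p i) ≤ log d := by
  have hd0 : (d : ℝ) ≠ 0 := by positivity
  have h := sum_negMulLog_le_neg_sum_mul_log (p := p) (w := fun _ => (d : ℝ)⁻¹) hp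
    (fun _ => by positivity) (by simp [hp1, hd0]) (fun i hi => absurd hi (inv_ne_zero hd0))
  rw [← sum_mul, hp1, log_inv] at h
  linarith

/-! ### Entropy of spikes and Fano's inequality -/

open Real in
theorem qaryEntropy_eq {d : ℕ} (s : ℝ) :
    qaryEntropy d s = s * log ((d : ℝ) - 1) + negMulLog s + negMulLog (1 - s) := by
  simp [qaryEntropy, binEntropy_eq_negMulLog_add_negMulLog_one_sub, add_assoc]

open Real in
/-- The entropy of the distribution `(1 - s, s / (d - 1), …, s / (d - 1))` is `qaryEntropy d s`. -/
theorem qaryEntropy_eq_spike {d : ℕ} (hd : 2 ≤ d) (s : ℝ) :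
    qaryEntropy d s = negMulLog (1 - s) + ((d : ℝ) - 1) * negMulLog (s / ((d : ℝ) - 1)) := by
  have hd1 : (0 : ℝ) < (d : ℝ) - 1 := cast_sub_one_pos hd
  rw [qaryEntropy_eq]
  rcases eq_or_ne s 0 with rfl | hs
  · simp
  · simp only [negMulLog]
    rw [log_div hs hd1.ne']
    field_simp
    ring

open Real Finset in
/-- **Fano's inequality** for a single distribution: concentrating the entropy of `q` on one point
`i` and spreading the remaining mass evenly does not decrease it. -/
theorem sum_negMulLog_le_qaryEntropy {d : ℕ} (hd : 2 ≤ d) {q : Fin d → ℝ} (hq : ∀ i, 0 ≤ q i)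
    (hq1 : ∑ i, q i = 1) (i : Fin d) :
    ∑ j, negMulLog (q j) ≤ qaryEntropy d (1 - q i) := by
  have hd1 : (0 : ℝ) < (d : ℝ) - 1 := cast_sub_one_pos hd
  have hcard : ((univ.erase i).card : ℝ) = (d : ℝ) - 1 := by
    rw [card_erase_of_mem (mem_univ i), card_univ, Fintype.card_fin, Nat.cast_sub (by omega)]
    simp
  have hrest : ∑ j ∈ univ.erase i, q j = 1 - q i := by
    rw [← hq1, ← add_sum_erase _ _ (mem_univ i)]
    ring
  have hJ := concaveOn_negMulLog.le_map_sum (t := univ.erase i)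
    (w := fun _ => ((d : ℝ) - 1)⁻¹) (p := q) (fun _ _ => by positivity)
    (by rw [sum_const, nsmul_eq_mul, hcard, mul_inv_cancel₀ hd1.ne']) (fun j _ => hq j)
  simp only [smul_eq_mul, ← mul_sum, hrest] at hJ
  rw [qaryEntropy_eq_spike hd, sub_sub_cancel, ← add_sum_erase _ _ (mem_univ i), div_eq_inv_mul]
  have := mul_le_mul_of_nonneg_left hJ hd1.le
  rw [mul_inv_cancel_left₀ hd1.ne'] at this
  linarith

open Real in
theorem qaryEntropy_strictMonoOn_Icc {d : ℕ} (hd : 2 ≤ d) :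
    StrictMonoOn (qaryEntropy d) (Set.Icc 0 (((d : ℝ) - 1) / d)) := by
  have h : ((d : ℝ) - 1) / d = 1 - 1 / d := by
    rw [sub_div, div_self (by positivity)]
  rw [h]
  exact qaryEntropy_strictMonoOn hd

open Real in
theorem qaryEntropy_top {d : ℕ} (hd : 2 ≤ d) : qaryEntropy d (((d : ℝ) - 1) / d) = log d := by
  have hd0 : (0 : ℝ) < d := by positivity
  have hd1 : (0 : ℝ) < (d : ℝ) - 1 := cast_sub_one_pos hd
  have h1 : 1 - ((d : ℝ) - 1) / d = (d : ℝ)⁻¹ := by field_simp; ring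
  have h2 : ((d : ℝ) - 1) / d / ((d : ℝ) - 1) = (d : ℝ)⁻¹ := by field_simp
  rw [qaryEntropy_eq_spike hd, h1, h2, negMulLog, log_inv]
  field_simp
  ring

open Real in
theorem exists_qaryEntropy_eq {d : ℕ} (hd : 2 ≤ d) {a : ℝ} (ha : a ∈ Set.Icc 0 (log d)) :
    ∃ s ∈ Set.Icc (0 : ℝ) (((d : ℝ) - 1) / d), qaryEntropy d s = a := by
  have hd1 : (0 : ℝ) ≤ (d : ℝ) - 1 := (cast_sub_one_pos hd).le
  have h := intermediate_value_Icc (a := (0 : ℝ)) (b := ((d : ℝ) - 1) / d) (by positivity)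
    (qaryEntropy_continuous (q := d)).continuousOn
  rw [qaryEntropy_zero, qaryEntropy_top hd] at h
  exact h ha

open Real in
/-- A distribution with the entropy of `(1 - r, r / (d - 1), …, r / (d - 1))` has no entry larger
than the largest entry of that distribution. -/
theorem le_one_sub_of_sum_negMulLog_eq {d : ℕ} (hd : 2 ≤ d) {q : Fin d → ℝ} (hq : ∀ i, 0 ≤ q i)
    (hq1 : ∑ i, q i = 1) {r : ℝ} (hr : r ∈ Set.Icc (0 : ℝ) (((d : ℝ) - 1) / d))
    (hH : ∑ j, negMulLog (q j) = qaryEntropy d r) (i : Fin d) : q i ≤ 1 - r := by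
  by_contra! h
  have hqi : q i ≤ 1 := hq1 ▸ Finset.single_le_sum (fun j _ => hq j) (Finset.mem_univ i)
  have h1 := sum_negMulLog_le_qaryEntropy hd hq hq1 i
  have h2 := qaryEntropy_strictMonoOn_Icc hd ⟨by linarith, by linarith [hr.2]⟩ hr
    (show 1 - q i < r by linarith)
  linarith

/-! ### Power sums at fixed entropy -/

open Real in
/-- Write `f x = x log x`, `g x = x ^ β`, and let `T f`, `T g` be their Taylor remainders of order
one at `u`. Then `T g / T f` takes its maximum over `[0, v]` at `v`. The difference
`N = T g v * T f - T f v * T g` has a double zero at `u` and a zero at `v`, and its derivative is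
concave as a function of `log x`. -/
theorem taylor_rpow_mul_taylor_mul_log_le {u v β : ℝ} (hu : 0 < u) (huv : u < v) (hβ : 0 < β)
    {x : ℝ} (hx : x ∈ Set.Icc 0 v) :
    (x ^ β - u ^ β - β * u ^ (β - 1) * (x - u)) *
        (v * log v - u * log u - (log u + 1) * (v - u)) ≤
      (v ^ β - u ^ β - β * u ^ (β - 1) * (v - u)) *
        (x * log x - u * log u - (log u + 1) * (x - u)) := by
  set F := v * log v - u * log u - (log u + 1) * (v - u) with hF
  set G := v ^ β - u ^ β - β * u ^ (β - 1) * (v - u) with hG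
  have hv : 0 < v := hu.trans huv
  have hF0 : 0 ≤ F := by
    have h := mul_le_mul_of_nonneg_left (log_le_sub_one_of_pos (div_pos hu hv)) hv.le
    rw [log_div hu.ne' hv.ne', mul_sub, mul_sub, mul_div_cancel₀ _ hv.ne'] at h
    rw [hF]
    linarith
  let N : ℝ → ℝ := fun x => G * (x * log x - u * log u - (log u + 1) * (x - u)) -
    (x ^ β - u ^ β - β * u ^ (β - 1) * (x - u)) * F
  let N' : ℝ → ℝ := fun x => G * (log x - log u) - β * (x ^ (β - 1) - u ^ (β - 1)) * F
  have hNu : N u = 0 := by simp [N]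
  have hNv : N v = 0 := by
    change G * F - G * F = 0
    ring
  have hNcont : Continuous N := by
    have h1 : Continuous fun x : ℝ => x ^ β := continuous_id.rpow_const fun _ => Or.inr hβ.le
    have h2 : Continuous fun x : ℝ => x * log x := continuous_mul_log
    fun_prop
  have hN' : ∀ y, 0 < y → HasDerivAt N (N' y) y := by
    intro y hy
    have h1 := hasDerivAt_mul_log hy.ne'
    have h2 := hasDerivAt_rpow_const (p := β) (Or.inl hy.ne')
    have h3 := ((((h1.sub_const (u * log u)).sub (((hasDerivAt_id y).sub_const u).const_mul
      (log u + 1))).const_mul G).sub ((((h2.sub_const (u ^ β)).sub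
      (((hasDerivAt_id y).sub_const u).const_mul (β * u ^ (β - 1)))).mul_const F)))
    refine h3.congr_deriv ?_
    simp only [N']
    ring
  obtain ⟨w, hw, hw0⟩ := exists_hasDerivAt_eq_zero (f := N) (f' := N') huv hNcont.continuousOn
    (by rw [hNu, hNv]) fun y hy => hN' y (hu.trans hy.1)
  have hwpos : 0 < w := hu.trans hw.1
  -- The derivative as a concave function of `t = log x`.
  let ψ : ℝ → ℝ := fun t => G * (t - log u) - β * (exp ((β - 1) * t) - u ^ (β - 1)) * F
  have hψ : ConcaveOn ℝ Set.univ ψ := by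
    have h1 : ConvexOn ℝ Set.univ fun t : ℝ => exp ((β - 1) * t) := by
      have := convexOn_exp.comp_linearMap ((β - 1) • (LinearMap.id : ℝ →ₗ[ℝ] ℝ))
      simpa [Function.comp_def] using this
    have h2 := (h1.smul (mul_nonneg hβ.le hF0)).neg
    have h3 : ConcaveOn ℝ Set.univ fun t : ℝ => G * t :=
      (LinearMap.lsmul ℝ ℝ G).concaveOn convex_univ
    have h4 := (h3.add h2).add_const (β * u ^ (β - 1) * F - G * log u)
    refine h4.congr fun t _ => ?_
    simp only [ψ, Pi.add_apply, Pi.neg_apply, smul_eq_mul]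
    ring
  have hψN : ∀ y, 0 < y → ψ (log y) = N' y := by
    intro y hy
    simp only [ψ, N', rpow_def_of_pos hy, mul_comm (log y)]
  have ha : ψ (log u) = 0 := by rw [hψN u hu]; simp [N']
  have hb : ψ (log w) = 0 := by rw [hψN w hwpos, hw0]
  have hab : log u < log w := log_lt_log hu hw.1
  have hneg1 : ∀ y, 0 < y → y < u → N' y ≤ 0 := by
    intro y hy hyu
    have hlt := log_lt_log hy hyu
    have := hψ.slope_anti_adjacent (Set.mem_univ (log y)) (Set.mem_univ (log w)) hlt hab
    rw [ha, hb, hψN y hy, sub_self, zero_div, le_div_iff₀ (by linarith)] at this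
    linarith
  have hpos : ∀ y, u < y → y < w → 0 ≤ N' y := by
    intro y huy hyw
    have hy := hu.trans huy
    have h1 := log_lt_log hu huy
    have h2 := log_lt_log hy hyw
    have := hψ.slope_anti_adjacent (Set.mem_univ (log u)) (Set.mem_univ (log w)) h1 h2
    rw [ha, hb, hψN y hy] at this
    by_contra! hlt
    have h3 : 0 < (0 - N' y) / (log w - log y) := div_pos (by linarith) (by linarith)
    have h4 : (N' y - 0) / (log y - log u) < 0 := div_neg_of_neg_of_pos (by linarith) (by linarith)
    linarith
  have hneg2 : ∀ y, w < y → N' y ≤ 0 := by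
    intro y hwy
    have hy := hwpos.trans hwy
    have h1 := log_lt_log hwpos hwy
    have := hψ.slope_anti_adjacent (Set.mem_univ (log u)) (Set.mem_univ (log y)) hab h1
    rw [ha, hb, hψN y hy, sub_self, zero_div, div_le_iff₀ (by linarith)] at this
    linarith
  have hmain : 0 ≤ N x := by
    rcases le_total x u with hxu | hux
    · rw [← hNu]
      refine antitoneOn_of_hasDerivWithinAt_nonpos (convex_Icc 0 u) hNcont.continuousOn
        (f' := N') (fun y hy => ?_) (fun y hy => ?_) ⟨hx.1, hxu⟩ ⟨hu.le, le_rfl⟩ hxu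
      all_goals rw [interior_Icc] at hy
      · exact (hN' y hy.1).hasDerivWithinAt
      · exact hneg1 y hy.1 hy.2
    rcases le_total x w with hxw | hwx
    · rw [← hNu]
      refine monotoneOn_of_hasDerivWithinAt_nonneg (convex_Icc u w) hNcont.continuousOn
        (f' := N') (fun y hy => ?_) (fun y hy => ?_) ⟨le_rfl, hw.1.le⟩ ⟨hux, hxw⟩ hux
      all_goals rw [interior_Icc] at hy
      · exact (hN' y (hu.trans hy.1)).hasDerivWithinAt
      · exact hpos y hy.1 hy.2
    · rw [← hNv]
      refine antitoneOn_of_hasDerivWithinAt_nonpos (convex_Icc w v) hNcont.continuousOn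
        (f' := N') (fun y hy => ?_) (fun y hy => ?_) ⟨hwx, hx.2⟩ ⟨hw.2.le, le_rfl⟩ hx.2
      all_goals rw [interior_Icc] at hy
      · exact (hN' y (hwpos.trans hy.1)).hasDerivWithinAt
      · exact hneg2 y hy.1
  exact sub_nonneg.1 hmain

open Real Finset in
/-- Among the distributions of given entropy, every power sum `∑ q ^ β` with `β > 0` is largest at
the spike `(1 - r, r / (d - 1), …, r / (d - 1))`. -/
theorem sum_rpow_le {d : ℕ} (hd : 2 ≤ d) {q : Fin d → ℝ} (hq : ∀ i, 0 ≤ q i)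
    (hq1 : ∑ i, q i = 1) {r : ℝ} (hr0 : 0 < r) (hr1 : r < ((d : ℝ) - 1) / d)
    (hH : ∑ j, negMulLog (q j) = qaryEntropy d r) {β : ℝ} (hβ : 0 < β) :
    ∑ j, q j ^ β ≤ (1 - r) ^ β + ((d : ℝ) - 1) * (r / ((d : ℝ) - 1)) ^ β := by
  have hd0 : (0 : ℝ) < d := by positivity
  have hd1 : (0 : ℝ) < (d : ℝ) - 1 := cast_sub_one_pos hd
  have hle := le_one_sub_of_sum_negMulLog_eq hd hq hq1 ⟨hr0.le, hr1.le⟩ hH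
  rw [qaryEntropy_eq_spike hd] at hH
  set u := r / ((d : ℝ) - 1) with hu
  have hru : r = ((d : ℝ) - 1) * u := by rw [hu]; field_simp
  have hu0 : 0 < u := div_pos hr0 hd1
  have huv : u < 1 - r := by
    rw [lt_div_iff₀ hd0] at hr1
    rw [hu, div_lt_iff₀ hd1]
    linarith
  have hF : 0 < (1 - r) * log (1 - r) - u * log u - (log u + 1) * ((1 - r) - u) := by
    have hv : 0 < 1 - r := hu0.trans huv
    have h := mul_lt_mul_of_pos_left (log_lt_sub_one_of_pos (div_pos hu0 hv)
      (by rw [Ne, div_eq_one_iff_eq hv.ne']; exact huv.ne)) hv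
    rw [log_div hu0.ne' hv.ne', mul_sub, mul_sub, mul_div_cancel₀ _ hv.ne'] at h
    linarith
  have hsum := sum_le_sum fun j (_ : j ∈ univ) =>
    taylor_rpow_mul_taylor_mul_log_le hu0 huv hβ ⟨hq j, hle j⟩
  rw [← sum_mul, ← mul_sum] at hsum
  -- Both distributions have the same mass and entropy, so the remainders of `x log x` agree.
  have hT : ∑ j, (q j * log (q j) - u * log u - (log u + 1) * (q j - u)) =
      (1 - r) * log (1 - r) - u * log u - (log u + 1) * ((1 - r) - u) := by
    simp only [negMulLog, neg_mul, sum_neg_distrib] at hH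
    simp only [sum_sub_distrib, ← mul_sum, hq1, sum_const, card_univ, Fintype.card_fin,
      nsmul_eq_mul]
    rw [hru] at hH ⊢
    linear_combination -hH
  rw [hT] at hsum
  have hg := le_of_mul_le_mul_right hsum hF
  simp only [sum_sub_distrib, ← mul_sum, hq1, sum_const, card_univ, Fintype.card_fin,
    nsmul_eq_mul] at hg
  have hexp : β * u ^ (β - 1) * (1 - r - u) = β * u ^ (β - 1) * (1 - d * u) := by
    rw [hru]; ring
  rw [hexp] at hg
  linarith

/-! ### Cross entropy at fixed entropies -/

open Real in
/-- The cross entropy `-∑ p log q` of the spikes with parameters `s` and `r`. -/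
noncomputable def spikeCrossEntropy (d : ℕ) (s r : ℝ) : ℝ :=
  -((1 - s) * log (1 - r) + s * log (r / ((d : ℝ) - 1)))

open Real in
/-- The Gibbs variational principle is an equality for two spikes, with the exponent `β` for which
the spike `s` is the normalised `β`-th power of the spike `r`. -/
theorem exists_log_sum_rpow_spike_eq {d : ℕ} (hd : 2 ≤ d) {s r : ℝ} (hs0 : 0 < s)
    (hs1 : s < ((d : ℝ) - 1) / d) (hr0 : 0 < r) (hr1 : r < ((d : ℝ) - 1) / d) :
    ∃ β : ℝ, 0 < β ∧ log ((1 - r) ^ β + ((d : ℝ) - 1) * (r / ((d : ℝ) - 1)) ^ β) =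
      qaryEntropy d s - β * spikeCrossEntropy d s r := by
  have hd0 : (0 : ℝ) < d := by positivity
  have hd1 : (0 : ℝ) < (d : ℝ) - 1 := cast_sub_one_pos hd
  have hlt : ∀ x : ℝ, x < ((d : ℝ) - 1) / d → x / ((d : ℝ) - 1) < 1 - x := by
    intro x hx
    rw [lt_div_iff₀ hd0] at hx
    rw [div_lt_iff₀ hd1]
    linarith
  have hsu := hlt s hs1
  have hru := hlt r hr1
  have hs0' : 0 < s / ((d : ℝ) - 1) := div_pos hs0 hd1
  have hr0' : 0 < r / ((d : ℝ) - 1) := div_pos hr0 hd1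
  rw [qaryEntropy_eq_spike hd, spikeCrossEntropy]
  have hs' : s = ((d : ℝ) - 1) * (s / ((d : ℝ) - 1)) := by field_simp
  set x := s / ((d : ℝ) - 1)
  set u := r / ((d : ℝ) - 1)
  have hv : 0 < 1 - r := hr0'.trans hru
  have hy : 0 < 1 - s := hs0'.trans hsu
  have hS : 0 < log (1 - s) - log x := sub_pos.2 (log_lt_log hs0' hsu)
  have hR : 0 < log (1 - r) - log u := sub_pos.2 (log_lt_log hr0' hru)
  refine ⟨(log (1 - s) - log x) / (log (1 - r) - log u), div_pos hS hR, ?_⟩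
  set β := (log (1 - s) - log x) / (log (1 - r) - log u)
  have hβ : β * (log (1 - r) - log u) = log (1 - s) - log x := div_mul_cancel₀ _ hR.ne'
  have hvβ : (1 - r) ^ β = u ^ β * ((1 - s) / x) := by
    rw [rpow_def_of_pos hv, rpow_def_of_pos hr0',
      show log (1 - r) * β = log u * β + (log (1 - s) - log x) by linarith, exp_add,
      ← log_div hy.ne' hs0'.ne', exp_log (div_pos hy hs0')]
  have hZ : (1 - r) ^ β + ((d : ℝ) - 1) * u ^ β = u ^ β / x := by
    rw [hvβ]
    field_simp
    linarith
  rw [hZ, log_div (rpow_pos_of_pos hr0' _).ne' hs0'.ne', log_rpow hr0', negMulLog, negMulLog]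
  have hdx : ((d : ℝ) - 1) * x = s := hs'.symm
  linear_combination (s - 1) * hβ + (log x) * hdx

open Real Finset in
/-- Among the pairs of distributions `p`, `q` where `q` has the entropy of the spike `r` and `p` has
at least the entropy of the spike `s`, the cross entropy is smallest for these two spikes. -/
theorem spikeCrossEntropy_le {d : ℕ} (hd : 2 ≤ d) {p q : Fin d → ℝ}
    (hp : ∀ i, 0 ≤ p i) (hp1 : ∑ i, p i = 1) (hq : ∀ i, 0 ≤ q i) (hq1 : ∑ i, q i = 1)
    (hpq : ∀ i, q i = 0 → p i = 0) {s r : ℝ} (hs : s ∈ Set.Icc (0 : ℝ) (((d : ℝ) - 1) / d))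
    (hr : r ∈ Set.Icc (0 : ℝ) (((d : ℝ) - 1) / d)) (hr0 : 0 < r)
    (hps : qaryEntropy d s ≤ ∑ i, negMulLog (p i))
    (hqr : ∑ i, negMulLog (q i) = qaryEntropy d r) :
    spikeCrossEntropy d s r ≤ -∑ i, p i * log (q i) := by
  have hd0 : (0 : ℝ) < d := by positivity
  have hd1 : (0 : ℝ) < (d : ℝ) - 1 := cast_sub_one_pos hd
  have hle := le_one_sub_of_sum_negMulLog_eq hd hq hq1 hr hqr
  -- Bounding every `q i` by `1 - r` settles the cases where `s = 0` or `q` is uniform.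
  have hE : -log (1 - r) ≤ -∑ i, p i * log (q i) := by
    have : ∀ i ∈ univ, p i * log (q i) ≤ p i * log (1 - r) := by
      intro i _
      rcases (hq i).eq_or_lt with h | h
      · simp [hpq i h.symm]
      · exact mul_le_mul_of_nonneg_left (log_le_log h (hle i)) (hp i)
    have := sum_le_sum this
    rw [← sum_mul, hp1] at this
    linarith
  rcases hs.1.eq_or_lt with rfl | hs0
  · simpa [spikeCrossEntropy] using hE
  rcases hr.2.eq_or_lt with hr1 | hr1
  · have : r / ((d : ℝ) - 1) = 1 - r := by
      rw [hr1]
      field_simp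
      ring
    rw [spikeCrossEntropy, this]
    linarith
  -- For `t < s` the exponent `β` belonging to the pair `(t, r)` is positive also when the spike `s`
  -- is uniform, and the error `H(t) - H(s)` has the right sign.
  have hbelow : ∀ t, 0 < t → t < s → spikeCrossEntropy d t r ≤ -∑ i, p i * log (q i) := by
    intro t ht0 hts
    have ht1 := hts.trans_le hs.2
    obtain ⟨β, hβ, hZ⟩ := exists_log_sum_rpow_spike_eq hd ht0 ht1 hr0 hr1
    have hmono := qaryEntropy_strictMonoOn_Icc hd ⟨ht0.le, ht1.le⟩ hs hts
    have hG := sum_negMulLog_le_log_sum_rpow hp hp1 hq hq1 hpq hβ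
    have hpos : 0 < ∑ i, q i ^ β := sum_rpow_pos hq hq1 β
    have hlog := log_le_log hpos (sum_rpow_le hd hq hq1 hr0 hr1 hqr hβ)
    rw [hZ] at hlog
    refine le_of_mul_le_mul_left ?_ hβ
    linarith
  have hcont : Filter.Tendsto (fun t => spikeCrossEntropy d t r) (nhdsWithin s (Set.Iio s))
      (nhds (spikeCrossEntropy d s r)) := by
    have : Continuous fun t => spikeCrossEntropy d t r := by
      unfold spikeCrossEntropy
      fun_prop
    exact (this.tendsto s).mono_left nhdsWithin_le_nhds
  refine le_of_tendsto hcont ?_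
  filter_upwards [Ioo_mem_nhdsLT hs0] with t ht using hbelow t ht.1 ht.2

open Real in
theorem binRelEntropy_eq {d : ℕ} (hd : 2 ≤ d) {s r : ℝ} (hs : s < 1) (hr0 : 0 < r) (hr1 : r < 1) :
    binRelEntropy s r = ((spikeCrossEntropy d s r - qaryEntropy d s : ℝ) : EReal) := by
  have hd1 : (0 : ℝ) < (d : ℝ) - 1 := cast_sub_one_pos hd
  rw [binRelEntropy, if_pos ⟨fun h => absurd h hr0.ne', fun h => absurd h (by linarith)⟩]
  congr 1
  rw [qaryEntropy_eq, spikeCrossEntropy, log_div (sub_pos.2 hs).ne' (sub_pos.2 hr1).ne',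
    log_div hr0.ne' hd1.ne', negMulLog, negMulLog]
  rcases eq_or_ne s 0 with rfl | hs0
  · simp
  · rw [log_div hs0 hr0.ne']
    ring

theorem binRelEntropy_zero_right {s : ℝ} (hs : s ≠ 0) : binRelEntropy s 0 = ⊤ := by
  simp [binRelEntropy, hs]

theorem binRelEntropy_zero_zero : binRelEntropy 0 0 = 0 := by
  simp [binRelEntropy]

open Real Finset in
/-- The classical form of the bound: the relative entropy of `p` and `q`, with the entropy of `p`
replaced by that of a less mixed spike `s`, is at least that of the spikes `s` and `r`. -/
theorem binRelEntropy_le {d : ℕ} (hd : 2 ≤ d) {p q : Fin d → ℝ}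
    (hp : ∀ i, 0 ≤ p i) (hp1 : ∑ i, p i = 1) (hq : ∀ i, 0 ≤ q i) (hq1 : ∑ i, q i = 1)
    (hpq : ∀ i, q i = 0 → p i = 0) {s r : ℝ} (hs : s ∈ Set.Icc (0 : ℝ) (((d : ℝ) - 1) / d))
    (hr : r ∈ Set.Icc (0 : ℝ) (((d : ℝ) - 1) / d))
    (hps : qaryEntropy d s ≤ ∑ i, negMulLog (p i))
    (hqr : ∑ i, negMulLog (q i) = qaryEntropy d r) :
    binRelEntropy s r ≤ ((-qaryEntropy d s - ∑ i, p i * log (q i) : ℝ) : EReal) := by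
  have htop : ((d : ℝ) - 1) / d < 1 := cast_sub_one_div_lt_one hd
  rcases hr.1.eq_or_lt with rfl | hr0
  · -- `q` is a point mass, so the cross entropy and hence the entropy of `p` vanish.
    rw [qaryEntropy_zero] at hqr
    have hq1' : ∀ i, q i ≤ 1 := fun i => hq1 ▸ single_le_sum (fun j _ => hq j) (mem_univ i)
    have hz := (sum_eq_zero_iff_of_nonneg fun i _ => negMulLog_nonneg (hq i) (hq1' i)).1 hqr
    have hlog : ∀ i, log (q i) = 0 := by
      intro i
      have := hz i (mem_univ i)
      rw [negMulLog, neg_mul, neg_eq_zero, mul_eq_zero] at this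
      rcases this with h | h
      · -- The entries `0` contribute the value `Real.log 0 = 0`, which is harmless as `p i = 0`.
        simp [h]
      · exact h
    have hH := sum_negMulLog_le_neg_sum_mul_log hp hq (hq1.trans hp1.symm).le hpq
    simp only [hlog, mul_zero, sum_const_zero, neg_zero] at hH ⊢
    have hs0 : s = 0 := by
      by_contra hne
      have := qaryEntropy_pos (q := d) (lt_of_le_of_ne hs.1 (Ne.symm hne)) (hs.2.trans_lt htop)
      linarith
    simp [hs0, binRelEntropy_zero_zero]
  · rw [binRelEntropy_eq hd (hs.2.trans_lt htop) hr0 (hr.2.trans_lt htop), EReal.coe_le_coe_iff]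
    have := spikeCrossEntropy_le hd hp hp1 hq hq1 hpq hs hr hr0 hps hqr
    linarith

/-! ### Spectral data of states -/

/-- The weight `⟨u, B u⟩` of `B` in the `j`-th vector `u` of the chosen eigenbasis of the Hermitian
matrix `A`: the `j`-th diagonal entry of `B` in that basis. Its real part is taken, which is no
restriction for Hermitian `B`. -/
noncomputable def eigenWeight {d : ℕ} {A : Matrix (Fin d) (Fin d) ℂ} (hA : A.IsHermitian)
    (B : Matrix (Fin d) (Fin d) ℂ) (j : Fin d) : ℝ :=
  (star (hA.eigenvectorUnitary : Matrix (Fin d) (Fin d) ℂ) * B *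
    (hA.eigenvectorUnitary : Matrix (Fin d) (Fin d) ℂ)) j j |>.re

open Matrix in
theorem trace_mul_cfc_re {d : ℕ} {A : Matrix (Fin d) (Fin d) ℂ} (hA : A.IsHermitian)
    (B : Matrix (Fin d) (Fin d) ℂ) (f : ℝ → ℝ) :
    (B * cfc f A).trace.re = ∑ j, eigenWeight hA B j * f (hA.eigenvalues j) := by
  rw [hA.cfc_eq, IsHermitian.cfc, Unitary.conjStarAlgAut_apply, ← mul_assoc, trace_mul_comm,
    ← mul_assoc, ← mul_assoc, trace, Complex.re_sum]
  refine Finset.sum_congr rfl fun j _ => ?_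
  rw [diag_apply, mul_diagonal, eigenWeight]
  simp

open Matrix in
theorem star_mul_self_mul_eq_diagonal {d : ℕ} {A : Matrix (Fin d) (Fin d) ℂ}
    (hA : A.IsHermitian) :
    star (hA.eigenvectorUnitary : Matrix (Fin d) (Fin d) ℂ) * A *
      (hA.eigenvectorUnitary : Matrix (Fin d) (Fin d) ℂ) =
      diagonal (fun i => (hA.eigenvalues i : ℂ)) := by
  have := hA.conjStarAlgAut_star_eigenvectorUnitary
  rwa [Unitary.conjStarAlgAut_star_apply] at this

open Matrix in
theorem eigenWeight_self {d : ℕ} {A : Matrix (Fin d) (Fin d) ℂ} (hA : A.IsHermitian) (j : Fin d) :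
    eigenWeight hA A j = hA.eigenvalues j := by
  rw [eigenWeight, star_mul_self_mul_eq_diagonal, diagonal_apply_eq, Complex.ofReal_re]

theorem entropy_eq_sum {d : ℕ} {A : Matrix (Fin d) (Fin d) ℂ} (hA : A.IsHermitian) :
    entropy A = ∑ j, Real.negMulLog (hA.eigenvalues j) := by
  rw [entropy, matLog, trace_mul_cfc_re hA, ← Finset.sum_neg_distrib]
  simp [eigenWeight_self, Real.negMulLog]

theorem IsState.eigenvalues_nonneg {d : ℕ} {ρ : Matrix (Fin d) (Fin d) ℂ} (h : IsState ρ)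
    (i : Fin d) : 0 ≤ h.posSemidef.1.eigenvalues i :=
  h.posSemidef.eigenvalues_nonneg i

theorem IsState.sum_eigenvalues {d : ℕ} {ρ : Matrix (Fin d) (Fin d) ℂ} (h : IsState ρ) :
    ∑ i, h.posSemidef.1.eigenvalues i = 1 := by
  have := h.posSemidef.1.trace_eq_sum_eigenvalues
  rw [h.trace_eq_one] at this
  exact Complex.ofReal_injective (by simpa using this.symm)

theorem eigenWeight_nonneg {d : ℕ} {A B : Matrix (Fin d) (Fin d) ℂ} (hA : A.IsHermitian)
    (hB : B.PosSemidef) (j : Fin d) : 0 ≤ eigenWeight hA B j := by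
  have h := (hB.conjTranspose_mul_mul_same
    (hA.eigenvectorUnitary : Matrix (Fin d) (Fin d) ℂ)).diag_nonneg (i := j)
  exact (Complex.nonneg_iff.1 h).1

open Matrix in
theorem sum_eigenWeight {d : ℕ} {A B : Matrix (Fin d) (Fin d) ℂ} (hA : A.IsHermitian)
    (hB : IsState B) : ∑ j, eigenWeight hA B j = 1 := by
  simp only [eigenWeight]
  rw [← Complex.re_sum]
  change (trace (star (hA.eigenvectorUnitary : Matrix (Fin d) (Fin d) ℂ) * B *
    (hA.eigenvectorUnitary : Matrix (Fin d) (Fin d) ℂ))).re = 1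
  have hUU' : (hA.eigenvectorUnitary : Matrix (Fin d) (Fin d) ℂ) *
      star (hA.eigenvectorUnitary : Matrix (Fin d) (Fin d) ℂ) = 1 := Unitary.coe_mul_star_self _
  rw [trace_mul_comm, ← mul_assoc, hUU', one_mul, hB.trace_eq_one,
    Complex.one_re]

open Matrix in
/-- Pinching to the eigenbasis of another matrix does not decrease the entropy: the weights of `B`
are averages of its eigenvalues with doubly stochastic coefficients. -/
theorem entropy_le_sum_negMulLog_eigenWeight {d : ℕ} {A B : Matrix (Fin d) (Fin d) ℂ}
    (hA : A.IsHermitian) (hB : B.PosSemidef) :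
    entropy B ≤ ∑ j, Real.negMulLog (eigenWeight hA B j) := by
  set U : Matrix (Fin d) (Fin d) ℂ := hA.eigenvectorUnitary.1 with hU
  set V : Matrix (Fin d) (Fin d) ℂ := hB.1.eigenvectorUnitary.1 with hV
  have hUU : star U * U = 1 := Unitary.coe_star_mul_self _
  have hUU' : U * star U = 1 := Unitary.coe_mul_star_self _
  have hVV : star V * V = 1 := Unitary.coe_star_mul_self _
  have hVV' : V * star V = 1 := Unitary.coe_mul_star_self _
  let W : Matrix (Fin d) (Fin d) ℂ := star U * V
  have hW : W * star W = 1 := by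
    simp only [W, star_mul, star_star]
    rw [mul_assoc, ← mul_assoc V, hVV', one_mul, hUU]
  have hW' : star W * W = 1 := by
    simp only [W, star_mul, star_star]
    rw [mul_assoc, ← mul_assoc U, hUU', one_mul, hVV]
  have hrow : ∀ j, ∑ i, Complex.normSq (W j i) = 1 := by
    intro j
    have := congrArg Complex.re (congrFun (congrFun hW j) j)
    simpa [mul_apply, star_apply, Complex.mul_conj, Complex.re_sum] using this
  have hcol : ∀ i, ∑ j, Complex.normSq (W j i) = 1 := by
    intro i
    have := congrArg Complex.re (congrFun (congrFun hW' i) i)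
    simpa [mul_apply, star_apply, mul_comm, Complex.mul_conj, Complex.re_sum] using this
  have hwt : ∀ j, eigenWeight hA B j =
      ∑ i, Complex.normSq (W j i) • hB.1.eigenvalues i := by
    intro j
    have hBe : star U * B * U =
        W * diagonal (fun i => (hB.1.eigenvalues i : ℂ)) * star W := by
      rw [← star_mul_self_mul_eq_diagonal, ← hV]
      simp only [W, star_mul, star_star]
      calc star U * B * U = star U * (V * star V) * B * (V * star V) * U := by
            simp [hVV']
        _ = _ := by simp only [mul_assoc]
    rw [eigenWeight, ← hU, hBe, mul_apply, Complex.re_sum]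
    refine Finset.sum_congr rfl fun i _ => ?_
    rw [mul_diagonal, star_apply, mul_right_comm,
      show W j i * star (W j i) = (Complex.normSq (W j i) : ℂ) from Complex.mul_conj _,
      ← Complex.ofReal_mul, Complex.ofReal_re, smul_eq_mul]
  rw [entropy_eq_sum hB.1]
  calc ∑ i, Real.negMulLog (hB.1.eigenvalues i)
      = ∑ j, ∑ i, Complex.normSq (W j i) • Real.negMulLog (hB.1.eigenvalues i) := by
        rw [Finset.sum_comm]
        simp only [smul_eq_mul, ← Finset.sum_mul, hcol, one_mul]
    _ ≤ _ := by
        refine Finset.sum_le_sum fun j _ => ?_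
        rw [hwt]
        exact Real.concaveOn_negMulLog.le_map_sum (fun i _ => Complex.normSq_nonneg _) (hrow j)
          fun i _ => hB.eigenvalues_nonneg i

open Matrix in
/-- The support of `B` is orthogonal to the kernel of `A` if it lies in the support of `A`. -/
theorem eigenWeight_eq_zero {d : ℕ} {A B : Matrix (Fin d) (Fin d) ℂ} (hA : A.IsHermitian)
    (hBA : matSupport B ≤ matSupport A) {j : Fin d} (hj : hA.eigenvalues j = 0) :
    eigenWeight hA B j = 0 := by
  set U : Matrix (Fin d) (Fin d) ℂ := hA.eigenvectorUnitary.1 with hU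
  have hUU' : U * star U = 1 := Unitary.coe_mul_star_self _
  have hUA : star U * A = diagonal (fun i => (hA.eigenvalues i : ℂ)) * star U := by
    rw [← star_mul_self_mul_eq_diagonal, ← hU, mul_assoc _ U, hUU', mul_one]
  obtain ⟨w, hw⟩ := hBA (⟨U.col j, rfl⟩ : B *ᵥ U.col j ∈ matSupport B)
  have h : (star U * B * U) j j = (star U *ᵥ (B *ᵥ U.col j)) j := by
    rw [mul_assoc]
    rfl
  have hw' : A *ᵥ w = B *ᵥ U.col j := hw
  rw [eigenWeight, ← hU, h, ← hw', mulVec_mulVec, hUA, ← mulVec_mulVec, mulVec_diagonal, hj]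
  simp

theorem entropy_mem_Icc {d : ℕ} (hd : 2 ≤ d) {ρ : Matrix (Fin d) (Fin d) ℂ} (h : IsState ρ) :
    entropy ρ ∈ Set.Icc 0 (Real.log d) := by
  rw [entropy_eq_sum h.posSemidef.1]
  refine ⟨Finset.sum_nonneg fun i _ => Real.negMulLog_nonneg (h.eigenvalues_nonneg i) ?_,
    sum_negMulLog_le_log_card hd h.eigenvalues_nonneg h.sum_eigenvalues⟩
  rw [← h.sum_eigenvalues]
  exact Finset.single_le_sum (fun j _ => h.eigenvalues_nonneg j) (Finset.mem_univ i)

/-- The spikes with the same entropies as `σ` and `ρ` have at most their relative entropy. -/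
theorem binRelEntropy_le_relEntropy {d : ℕ} (hd : 2 ≤ d) {σ ρ : Matrix (Fin d) (Fin d) ℂ}
    (hσ : IsState σ) (hρ : IsState ρ) {s r : ℝ}
    (hs : s ∈ Set.Icc (0 : ℝ) (((d : ℝ) - 1) / d))
    (hr : r ∈ Set.Icc (0 : ℝ) (((d : ℝ) - 1) / d))
    (hSs : Real.qaryEntropy d s = entropy σ) (hSr : Real.qaryEntropy d r = entropy ρ) :
    binRelEntropy s r ≤ relEntropy σ ρ := by
  rw [relEntropy]
  split_ifs with hsupp
  · have hA := hρ.posSemidef.1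
    have h := binRelEntropy_le hd (p := eigenWeight hA σ) (q := hA.eigenvalues)
      (eigenWeight_nonneg hA hσ.posSemidef) (sum_eigenWeight hA hσ) hρ.eigenvalues_nonneg
      hρ.sum_eigenvalues (fun i hi => eigenWeight_eq_zero hA hsupp hi) hs hr
      (hSs.trans_le (entropy_le_sum_negMulLog_eigenWeight hA hσ.posSemidef))
      (by rw [hSr, entropy_eq_sum hA])
    rw [← trace_mul_cfc_re hA, hSs, entropy, neg_neg] at h
    exact h
  · exact le_top

/-! ### Diagonal matrices and spike states -/

open Matrix in
/-- The functional calculus acts entrywise on a real diagonal matrix: an eigenvector for `λ` is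
supported on the coordinates whose entry is `λ`. -/
theorem cfc_diagonal {d : ℕ} (g : Fin d → ℝ) (f : ℝ → ℝ) :
    cfc f (diagonal fun i => (g i : ℂ)) = diagonal fun i => (f (g i) : ℂ) := by
  have hA : (diagonal fun i => (g i : ℂ)).IsHermitian :=
    isHermitian_diagonal_of_self_adjoint _ (by ext i; simp)
  rw [hA.cfc_eq, IsHermitian.cfc, Unitary.conjStarAlgAut_apply]
  set U : Matrix (Fin d) (Fin d) ℂ := hA.eigenvectorUnitary.1 with hU
  have hUU' : U * star U = 1 := Unitary.coe_mul_star_self _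
  have hAU : (diagonal fun i => (g i : ℂ)) * U =
      U * diagonal (fun i => (hA.eigenvalues i : ℂ)) := by
    rw [← star_mul_self_mul_eq_diagonal, ← hU, ← mul_assoc, ← mul_assoc, hUU', one_mul]
  have hfU : U * diagonal (RCLike.ofReal ∘ f ∘ hA.eigenvalues) =
      (diagonal fun i => (f (g i) : ℂ)) * U := by
    ext i j
    have h := congrFun (congrFun hAU i) j
    rw [diagonal_mul, mul_diagonal, mul_comm, mul_eq_mul_left_iff] at h
    rw [diagonal_mul, mul_diagonal]
    rcases h with h | h
    · rw [Complex.ofReal_inj] at h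
      simp [h, mul_comm]
    · simp [h]
  rw [hfU, mul_assoc, hUU', mul_one]

open Matrix in
theorem trace_diagonal_mul_matLog_re {d : ℕ} (p q : Fin d → ℝ) :
    ((diagonal fun i => (p i : ℂ)) * matLog (diagonal fun i => (q i : ℂ))).trace.re =
      ∑ i, p i * Real.log (q i) := by
  rw [matLog, cfc_diagonal, diagonal_mul_diagonal, trace_diagonal, Complex.re_sum]
  simp only [← Complex.ofReal_mul, Complex.ofReal_re]

theorem sum_spike {d : ℕ} (hd : 2 ≤ d) (x y : ℝ) :
    ∑ i : Fin d, (if (i : ℕ) = 0 then x else y) = x + ((d : ℝ) - 1) * y := by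
  obtain ⟨n, rfl⟩ : ∃ n, d = n + 1 := ⟨d - 1, by omega⟩
  simp [Fin.sum_univ_succ]

open Matrix in
theorem isState_spikeState {d : ℕ} (hd : 2 ≤ d) {s : ℝ} (hs0 : 0 ≤ s) (hs1 : s ≤ 1) :
    IsState (spikeState d s) := by
  have hd1 : (0 : ℝ) < (d : ℝ) - 1 := cast_sub_one_pos hd
  refine ⟨PosSemidef.diagonal fun i => ?_, ?_⟩
  · rw [Pi.zero_apply, Complex.zero_le_real]
    split_ifs
    · linarith
    · positivity
  · rw [spikeState, trace_diagonal, ← Complex.ofReal_sum, sum_spike hd,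
      mul_div_cancel₀ _ hd1.ne', sub_add_cancel, Complex.ofReal_one]

open Matrix in
theorem trace_spikeState_mul_matLog_re {d : ℕ} (hd : 2 ≤ d) (s r : ℝ) :
    (spikeState d s * matLog (spikeState d r)).trace.re = -spikeCrossEntropy d s r := by
  have hd1 : (0 : ℝ) < (d : ℝ) - 1 := cast_sub_one_pos hd
  rw [spikeState, spikeState, trace_diagonal_mul_matLog_re]
  have : ∀ i : Fin d, (if (i : ℕ) = 0 then 1 - s else s / ((d : ℝ) - 1)) *
      Real.log (if (i : ℕ) = 0 then 1 - r else r / ((d : ℝ) - 1)) =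
      if (i : ℕ) = 0 then (1 - s) * Real.log (1 - r)
      else s / ((d : ℝ) - 1) * Real.log (r / ((d : ℝ) - 1)) := by
    intro i
    split_ifs <;> rfl
  simp only [this]
  rw [sum_spike hd, spikeCrossEntropy, ← mul_assoc, mul_div_cancel₀ _ hd1.ne', neg_neg]

theorem spikeCrossEntropy_self {d : ℕ} (hd : 2 ≤ d) (s : ℝ) :
    spikeCrossEntropy d s s = Real.qaryEntropy d s := by
  have hd1 : (0 : ℝ) < (d : ℝ) - 1 := cast_sub_one_pos hd
  rw [qaryEntropy_eq_spike hd, spikeCrossEntropy, Real.negMulLog, Real.negMulLog]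
  field_simp
  ring

theorem entropy_spikeState {d : ℕ} (hd : 2 ≤ d) (s : ℝ) :
    entropy (spikeState d s) = Real.qaryEntropy d s := by
  rw [entropy, trace_spikeState_mul_matLog_re hd, neg_neg, spikeCrossEntropy_self hd]

open Matrix in
theorem relEntropy_spikeState {d : ℕ} (hd : 2 ≤ d) {s r : ℝ} (hs0 : 0 ≤ s) (hs : s < 1)
    (hr0 : 0 ≤ r) (hr : r < 1) :
    relEntropy (spikeState d s) (spikeState d r) = binRelEntropy s r := by
  have hd1 : (0 : ℝ) < (d : ℝ) - 1 := cast_sub_one_pos hd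
  rcases hr0.eq_or_lt with rfl | hr0
  · rcases hs0.eq_or_lt with rfl | hs0
    · rw [relEntropy, if_pos le_rfl, binRelEntropy_zero_zero, sub_self, EReal.coe_zero]
    · rw [binRelEntropy_zero_right hs0.ne', relEntropy, if_neg]
      -- The second basis vector is in the support of the spike `s`, not in that of the spike `0`.
      intro hle
      obtain ⟨w, hw⟩ := hle (⟨Pi.single ⟨1, by omega⟩ 1, rfl⟩ :
        spikeState d s *ᵥ Pi.single ⟨1, by omega⟩ 1 ∈ matSupport (spikeState d s))
      have h := congrFun hw ⟨1, by omega⟩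
      simp only [mulVecLin_apply, spikeState, mulVec_diagonal, Pi.single_eq_same] at h
      simp only [one_ne_zero, if_false, zero_div, Complex.ofReal_zero, zero_mul, mul_one] at h
      exact (div_pos hs0 hd1).ne (by exact_mod_cast h)
  · have hsupp : matSupport (spikeState d s) ≤ matSupport (spikeState d r) := by
      rintro x -
      refine ⟨fun i => (((if (i : ℕ) = 0 then 1 - r else r / ((d : ℝ) - 1) : ℝ) : ℂ))⁻¹ * x i, ?_⟩
      ext i
      rw [mulVecLin_apply, spikeState, mulVec_diagonal, mul_inv_cancel_left₀]
      rw [Complex.ofReal_ne_zero]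
      split_ifs
      · linarith
      · positivity
    rw [relEntropy, if_pos hsupp, binRelEntropy_eq hd hs hr0 hr, trace_spikeState_mul_matLog_re hd,
      trace_spikeState_mul_matLog_re hd, spikeCrossEntropy_self hd]
    congr 1
    ring

/-! ### Lower semicontinuity of the binary relative entropy -/

theorem binRelEntropy_nonneg {s r : ℝ} (hs0 : 0 ≤ s) (hs : s < 1) (hr0 : 0 ≤ r) (hr : r < 1) :
    0 ≤ binRelEntropy s r := by
  rcases hr0.eq_or_lt with rfl | hr0
  · rcases eq_or_ne s 0 with rfl | h
    · rw [binRelEntropy_zero_zero]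
    · rw [binRelEntropy_zero_right h]
      exact le_top
  · have h := sum_negMulLog_le_neg_sum_mul_log (p := ![1 - s, s]) (w := ![1 - r, r])
      (by simp [Fin.forall_fin_two, hs.le, hs0]) (by simp [Fin.forall_fin_two, hr.le, hr0.le])
      (by simp) (by simp [Fin.forall_fin_two, hr0.ne', (sub_pos.2 hr).ne'])
    rw [binRelEntropy_eq le_rfl hs hr0 hr, EReal.coe_nonneg, sub_nonneg, spikeCrossEntropy,
      qaryEntropy_eq_spike le_rfl]
    norm_num at h ⊢
    linarith

open Filter Topology in
/-- The binary relative entropy is lower semicontinuous on a square that stays away from `1`. It is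
continuous where `r > 0`, tends to `+∞` at the points `(s, 0)` with `s > 0`, and takes its smallest
value `0` at the origin. -/
theorem lowerSemicontinuousOn_binRelEntropy {c : ℝ} (hc : c < 1) :
    LowerSemicontinuousOn (fun p : ℝ × ℝ => binRelEntropy p.1 p.2)
      (Set.Icc 0 c ×ˢ Set.Icc 0 c) := by
  rintro ⟨s, r⟩ ⟨hs, hr⟩
  simp only at hs hr
  rcases hr.1.eq_or_lt with rfl | hr0
  · rcases hs.1.eq_or_lt with rfl | hs0
    · intro y hy
      simp only [binRelEntropy_zero_zero] at hy
      filter_upwards [self_mem_nhdsWithin] with p hp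
      exact hy.trans_le (binRelEntropy_nonneg hp.1.1 (hp.1.2.trans_lt hc) hp.2.1
        (hp.2.2.trans_lt hc))
    · intro y hy
      obtain ⟨N, hN, -⟩ := EReal.lt_iff_exists_real_btwn.1 hy
      -- For `s > s₀ / 2` the value is at least `(s₀ / 2) * (-log r) - log 2`.
      set K : ℝ := (|N| + Real.log 2) * 2 / s with hK
      have hK0 : 0 ≤ K := by
        have := Real.log_nonneg (one_le_two (α := ℝ))
        positivity
      have h1 : ∀ᶠ p : ℝ × ℝ in 𝓝 (s, 0), s / 2 < p.1 :=
        continuous_fst.continuousAt.eventually (lt_mem_nhds (by simpa using hs0))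
      have h2 : ∀ᶠ p : ℝ × ℝ in 𝓝 (s, 0), p.2 < Real.exp (-K) :=
        continuous_snd.continuousAt.eventually (gt_mem_nhds (Real.exp_pos _))
      filter_upwards [self_mem_nhdsWithin, nhdsWithin_le_nhds h1, nhdsWithin_le_nhds h2]
        with p hp h1 h2
      have hp1 : p.1 < 1 := hp.1.2.trans_lt hc
      have hp2 : p.2 < 1 := hp.2.2.trans_lt hc
      refine hN.trans_le ?_
      rcases hp.2.1.eq_or_lt with h0 | h0
      · rw [← h0, binRelEntropy_zero_right (by linarith)]
        exact le_top
      · rw [binRelEntropy_eq le_rfl hp1 h0 hp2, EReal.coe_le_coe_iff, spikeCrossEntropy]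
        have hlog : Real.log p.2 < -K := (Real.log_lt_iff_lt_exp h0).2 h2
        have hlog' : Real.log (1 - p.2) ≤ 0 := Real.log_nonpos (by linarith) (by linarith)
        have hbin : Real.binEntropy p.1 ≤ Real.log 2 := Real.binEntropy_le_log_two
        have h3 : (1 - p.1) * Real.log (1 - p.2) ≤ 0 :=
          mul_nonpos_of_nonneg_of_nonpos (by linarith) hlog'
        have h4 : s / 2 * K ≤ p.1 * -Real.log p.2 :=
          mul_le_mul h1.le (by linarith) hK0 hp.1.1
        have h5 : s / 2 * K = |N| + Real.log 2 := by
          rw [hK]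
          field_simp
        have h6 := le_abs_self N
        norm_num
        linarith
  · refine ContinuousWithinAt.lowerSemicontinuousWithinAt ?_
    have hr1 : r < 1 := hr.2.trans_lt hc
    have hcont : ContinuousAt (fun p : ℝ × ℝ =>
        ((spikeCrossEntropy 2 p.1 p.2 - Real.qaryEntropy 2 p.1 : ℝ) : EReal)) (s, r) := by
      refine continuous_coe_real_ereal.continuousAt.comp ?_
      have h1 : ContinuousAt (fun p : ℝ × ℝ => Real.log (1 - p.2)) (s, r) :=
        ContinuousAt.log (by fun_prop) (sub_pos.2 hr1).ne'
      have h2 : ContinuousAt (fun p : ℝ × ℝ => Real.log (p.2 / (((2 : ℕ) : ℝ) - 1))) (s, r) :=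
        ContinuousAt.log (by fun_prop) (by norm_num; exact hr0.ne')
      unfold spikeCrossEntropy
      fun_prop
    refine hcont.continuousWithinAt.congr_of_eventuallyEq ?_
      (binRelEntropy_eq le_rfl (hs.2.trans_lt hc) hr0 hr1)
    have hpos : ∀ᶠ p : ℝ × ℝ in 𝓝 (s, r), 0 < p.2 :=
      continuous_snd.continuousAt.eventually (lt_mem_nhds hr0)
    filter_upwards [self_mem_nhdsWithin, nhdsWithin_le_nhds hpos] with p hp hp0
    exact binRelEntropy_eq le_rfl (hp.1.2.trans_lt hc) hp0 (hp.2.2.trans_lt hc)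

/-! ### Feasible pairs and the minimum -/

theorem mem_feasiblePairs {Δ : ℝ} {d : ℕ} {s r : ℝ} :
    (s, r) ∈ feasiblePairs Δ d ↔ s ∈ Set.Icc (0 : ℝ) (((d : ℝ) - 1) / d) ∧
      r ∈ Set.Icc (0 : ℝ) (((d : ℝ) - 1) / d) ∧
      Real.qaryEntropy d s - Real.qaryEntropy d r = Δ := by
  have : Real.qaryEntropy d s - Real.qaryEntropy d r =
      Real.binEntropy s - Real.binEntropy r + (s - r) * Real.log ((d : ℝ) - 1) := by
    simp only [Real.qaryEntropy]
    push_cast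
    ring
  rw [this]
  rfl

theorem feasiblePairs_nonempty {Δ : ℝ} {d : ℕ} (hd : 2 ≤ d)
    (hΔ : Δ ∈ Set.Icc (-Real.log d) (Real.log d)) : (feasiblePairs Δ d).Nonempty := by
  have hd1 : (0 : ℝ) ≤ (d : ℝ) - 1 := (cast_sub_one_pos hd).le
  have h0 : (0 : ℝ) ∈ Set.Icc (0 : ℝ) (((d : ℝ) - 1) / d) := ⟨le_rfl, by positivity⟩
  rcases le_total 0 Δ with h | h
  · obtain ⟨s, hs, hsΔ⟩ := exists_qaryEntropy_eq hd ⟨h, hΔ.2⟩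
    exact ⟨(s, 0), mem_feasiblePairs.2 ⟨hs, h0, by rw [hsΔ, Real.qaryEntropy_zero, sub_zero]⟩⟩
  · obtain ⟨r, hr, hrΔ⟩ := exists_qaryEntropy_eq hd (a := -Δ) ⟨by linarith, by linarith [hΔ.1]⟩
    exact ⟨(0, r), mem_feasiblePairs.2 ⟨h0, hr, by
      rw [hrΔ, Real.qaryEntropy_zero, zero_sub, neg_neg]⟩⟩

theorem exists_isMinimizingPair {Δ : ℝ} {d : ℕ} (hd : 2 ≤ d)
    (hΔ : Δ ∈ Set.Icc (-Real.log d) (Real.log d)) : ∃ s r : ℝ, IsMinimizingPair Δ d s r := by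
  have hc : ((d : ℝ) - 1) / d < 1 := cast_sub_one_div_lt_one hd
  have hsub : feasiblePairs Δ d ⊆
      Set.Icc (0 : ℝ) (((d : ℝ) - 1) / d) ×ˢ Set.Icc (0 : ℝ) (((d : ℝ) - 1) / d) :=
    fun p hp => ⟨hp.1, hp.2.1⟩
  have hclosed : IsClosed (feasiblePairs Δ d) := by
    have : feasiblePairs Δ d =
        (Set.Icc (0 : ℝ) (((d : ℝ) - 1) / d) ×ˢ Set.Icc (0 : ℝ) (((d : ℝ) - 1) / d)) ∩
          {p | Real.binEntropy p.1 - Real.binEntropy p.2 +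
            (p.1 - p.2) * Real.log ((d : ℝ) - 1) = Δ} := by
      ext p
      exact and_assoc.symm
    rw [this]
    exact (isClosed_Icc.prod isClosed_Icc).inter (isClosed_eq (by fun_prop) continuous_const)
  have hcomp : IsCompact (feasiblePairs Δ d) :=
    (isCompact_Icc.prod isCompact_Icc).of_isClosed_subset hclosed hsub
  obtain ⟨⟨s, r⟩, hmem, hmin⟩ := LowerSemicontinuousOn.exists_isMinOn
    (feasiblePairs_nonempty hd hΔ) hcomp ((lowerSemicontinuousOn_binRelEntropy hc).mono hsub)
  exact ⟨s, r, hmem, hmin⟩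

theorem IsMinimizingPair.binRelEntropy_eq {Δ : ℝ} {d : ℕ} {s r : ℝ}
    (h : IsMinimizingPair Δ d s r) : binRelEntropy s r = entropyGapBound Δ d :=
  le_antisymm (le_iInf₂ fun _ hp => isMinOn_iff.1 h.2 _ hp) (iInf₂_le (s, r) h.1)

/-- The spikes of a minimising pair have entropy difference `Δ`, and they attain the bound. -/
theorem IsMinimizingPair.spikeState_spec {Δ : ℝ} {d : ℕ} (hd : 2 ≤ d) {s r : ℝ}
    (h : IsMinimizingPair Δ d s r) :
    IsState (spikeState d s) ∧ IsState (spikeState d r) ∧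
      Commute (spikeState d s) (spikeState d r) ∧
      entropy (spikeState d s) - entropy (spikeState d r) = Δ ∧
      relEntropy (spikeState d s) (spikeState d r) = entropyGapBound Δ d := by
  have hc : ((d : ℝ) - 1) / d < 1 := cast_sub_one_div_lt_one hd
  obtain ⟨hs, hr, hΔ⟩ := mem_feasiblePairs.1 h.1
  have hs1 := hs.2.trans_lt hc
  have hr1 := hr.2.trans_lt hc
  refine ⟨isState_spikeState hd hs.1 hs1.le, isState_spikeState hd hr.1 hr1.le,
    Matrix.commute_diagonal _ _, ?_, ?_⟩
  · rw [entropy_spikeState hd, entropy_spikeState hd, hΔ]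
  · rw [relEntropy_spikeState hd hs.1 hs1 hr.1 hr1, h.binRelEntropy_eq]

theorem theorem1 (d : ℕ) (hd : 2 ≤ d) :
    (∀ σ ρ : Matrix (Fin d) (Fin d) ℂ, IsState σ → IsState ρ →
      entropy σ - entropy ρ ∈ Set.Icc (-Real.log d) (Real.log d) ∧
      entropyGapBound (entropy σ - entropy ρ) d ≤ relEntropy σ ρ) ∧
    (∀ Δ ∈ Set.Icc (-Real.log d) (Real.log d),
      (∃ s r : ℝ, IsMinimizingPair Δ d s r) ∧
      (∃ σ ρ : Matrix (Fin d) (Fin d) ℂ,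
        IsState σ ∧ IsState ρ ∧ σ.IsDiag ∧ ρ.IsDiag ∧
        entropy σ - entropy ρ = Δ ∧ relEntropy σ ρ = entropyGapBound Δ d) ∧
      (∀ s r : ℝ, IsMinimizingPair Δ d s r →
        IsState (spikeState d s) ∧ IsState (spikeState d r) ∧
        Commute (spikeState d s) (spikeState d r) ∧
        entropy (spikeState d s) - entropy (spikeState d r) = Δ ∧
        relEntropy (spikeState d s) (spikeState d r) = entropyGapBound Δ d)) := by
  refine ⟨fun σ ρ hσ hρ => ?_, fun Δ hΔ => ⟨exists_isMinimizingPair hd hΔ, ?_,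
    fun s r h => h.spikeState_spec hd⟩⟩
  · have ha := entropy_mem_Icc hd hσ
    have hb := entropy_mem_Icc hd hρ
    obtain ⟨s, hs, hSs⟩ := exists_qaryEntropy_eq hd ha
    obtain ⟨r, hr, hSr⟩ := exists_qaryEntropy_eq hd hb
    refine ⟨⟨by linarith [ha.1, hb.2], by linarith [ha.2, hb.1]⟩, ?_⟩
    exact (iInf₂_le (s, r) (mem_feasiblePairs.2 ⟨hs, hr, by rw [hSs, hSr]⟩)).trans
      (binRelEntropy_le_relEntropy hd hσ hρ hs hr hSs hSr)
  · obtain ⟨s, r, h⟩ := exists_isMinimizingPair hd hΔ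
    obtain ⟨h1, h2, -, h3, h4⟩ := h.spikeState_spec hd
    exact ⟨spikeState d s, spikeState d r, h1, h2, Matrix.isDiag_diagonal _,
      Matrix.isDiag_diagonal _, h3, h4⟩
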